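/- Let $r,s,n$ be non-negative integers. An $r\times s$ partial Latin rectangle based on $[n]=\{1,\ldots,n\}$ is an $r\times s$ array in which each cell is either empty or contains one symbol of $[n]$, such that each symbol occurs at most once in each row and at most once in each column. Its size is the number of its non-empty cells. Let $\mathcal{R}_{r,s,n:m}$ be the set of $r\times s$ partial Latin rectangles based on $[n]$ of size $m$. For integers $a,b,c\ge 0$, let $\overline{abc}=\sum r^{a'}s^{b'}n^{c'}$, where the sum is over the distinct rearrangements $(a',b',c')$ of $(a,b,c)$; for instance $\overline{111}=rsn$ and $\overline{211}=r^2sn+rs^2n+rsn^2$. Then: - $|\mathcal{R}_{r,s,n:0}|=1$ - $|\mathcal{R}_{r,s,n:1}| = \overline{111}$ - $2!\,|\mathcal{R}_{r,s,n:2}| = \overline{111}(\overline{111} -\,\overline{100} +2)$ - $3!\,|\mathcal{R}_{r,s,n:3}| = \overline{111}(\overline{222} -3\,\overline{211} +6(\overline{111} +\,\overline{110} ) + 2\,\overline{200} -12\,\overline{100} +14)$ - $4!\,|\mathcal{R}_{r,s,n:4}| = \overline{111}(\overline{333} - 6\,\overline{322} + 12\,\overline{222} + 11\,\overline{311} + 30\,\overline{221}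 - 60\,\overline{211} - 6\,\overline{300} - 36\,\overline{210} - 28\,\overline{111} +72\,\overline{200} +198\,\overline{110} -228\,\overline{100} +198)$ - $5!\,|\mathcal{R}_{r,s,n:5}| = \overline{111}(\overline{444} -10\,\overline{433} + 20\,\overline{333} +35\,\overline{422} +90\,\overline{332} -180\,\overline{322} -50\,\overline{411} -260\,\overline{321} -460\,\overline{222} +520\,\overline{311} +1350\,\overline{221} + 24\,\overline{400} +240\,\overline{310} +480\,\overline{220} -320\,\overline{211} -480\,\overline{300} -2520\,\overline{210} -5090\,\overline{111} +2880\,\overline{200} +7440\,\overline{110} -6360\,\overline{100} +4512)$ - $6!\,|\mathcal{R}_{r,s,n:6}| = \overline{111}(\overline{555} -15\,\overline{544} +30\,\overline{444} +85\,\overline{533} +210\,\overline{443} -420\,\overline{433} -225\,\overline{522} -1065\,\overline{432} - 2150\,\overline{333} +2130\,\overline{422} +5310\,\overline{332} +274\,\overline{511} +2310\,\overline{421} +4400\,\overline{331} +4800\,\overline{322} -4620\,\overline{411} - 22170\,\overline{321} -49500\,\overline{222} - 120\,\overline{500} - 1800\,\overline{410} - 6000\,\overline{320} + 10460\,\overline{311}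 +34980\,\overline{221} + 3600\,\overline{400} +30600\,\overline{310} +58440\,\overline{220} +88710\,\overline{211} - 34800\,\overline{300} - 165480\,\overline{210} -364268\,\overline{111} + 140040\,\overline{200} +344520\,\overline{110} -240720\,\overline{100} +146400)$ -/

import Mathlib

/-- The `r × s` array `P` (a cell is `none` if it is empty) is a partial Latin rectangle on the
`n` symbols of `Fin n`: each symbol occurs at most once in each row and in each column. -/
def IsPartialLatinRectangle {r s n : ℕ} (P : Fin r → Fin s → Option (Fin n)) : Prop :=
  (∀ (i : Fin r) (j j' : Fin s) (k : Fin n), P i j = some k → P i j' = some k → j = j') ∧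
  (∀ (i i' : Fin r) (j : Fin s) (k : Fin n), P i j = some k → P i' j = some k → i = i')

/-- The number of non-empty cells of an array. -/
def arraySize {r s n : ℕ} (P : Fin r → Fin s → Option (Fin n)) : ℕ :=
  (Finset.univ.filter fun c : Fin r × Fin s => (P c.1 c.2).isSome = true).card

/-- The set of `r × s` partial Latin rectangles on `n` symbols of size `m`. -/
def partialLatinRectangles (r s n m : ℕ) : Set (Fin r → Fin s → Option (Fin n)) :=
  {P | IsPartialLatinRectangle P ∧ arraySize P = m}

/-- The symmetric monomial `overline{abc}` at `(r, s, n)`: the sum of `r ^ a' * s ^ b' * n ^ c'`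
over the distinct rearrangements `(a', b', c')` of `(a, b, c)`. -/
def symMon (r s n : ℕ) (a b c : ℕ) : ℤ :=
  ∑ e ∈ ({(a, b, c), (a, c, b), (b, a, c), (b, c, a), (c, a, b), (c, b, a)} :
      Finset (ℕ × ℕ × ℕ)),
    (r : ℤ) ^ e.1 * (s : ℤ) ^ e.2.1 * (n : ℤ) ^ e.2.2

/-! Numbering the filled cells of a rectangle of size `m` in all `m!` ways turns it into `m`-tuples
of triples (row, column, symbol). The tuples that arise are exactly those in which any two
coordinate functions together separate the `m` indices (`entries_bijective`).

Whether three functions on `Fin m` separate pairwise depends only on their kernels, which are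
partitions of `Fin m`. Each function is uniquely a restricted growth map followed by an injection,
and there are `(r)_a` injections of `a` blocks into `r` values. Hence (`factorial_mul_ncard`) `m!
|R|` is the sum of `N(a,b,c) (r)_a (s)_b (n)_c`, where `N = separatingCount m` counts triples of
partitions with `a`, `b`, `c` blocks, no two of which put the same pair in a block.

`N` is symmetric and vanishes when a product of two block numbers is below `m`. The few remaining
values are computed with bit masks, and expanding the falling factorials gives the formulas. -/

/-! ### Functions as set partitions followed by injections -/

/-- The restricted growth maps `Fin m → Fin k`: one representative, up to relabelling, of each
partition of `Fin m` into `k` blocks. -/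
def growthMaps : (m k : ℕ) → List (Fin m → Fin k)
  | 0, 0 => [Fin.elim0]
  | 0, _ + 1 => []
  | _ + 1, 0 => []
  | m + 1, k + 1 =>
      ((growthMaps m (k + 1)).flatMap fun w => (List.finRange (k + 1)).map fun j => Fin.cons j w) ++
        (growthMaps m k).map fun w => Fin.cons 0 (Fin.succ ∘ w)

theorem growthMaps_eq_nil : ∀ {m k : ℕ}, m < k → growthMaps m k = []
  | 0, k + 1, _ => rfl
  | m + 1, k + 1, h => by
      simp [growthMaps, growthMaps_eq_nil (show m < k + 1 by omega),
        growthMaps_eq_nil (show m < k by omega)]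

open Classical in
theorem sum_embedding_succ {α : Type*} [Fintype α] (k : ℕ) (F : (Fin (k + 1) → α) → ℕ) :
    ∑ e : Fin (k + 1) ↪ α, F e =
      ∑ e : Fin k ↪ α, ∑ x : {x // x ∉ Set.range e}, F (Fin.cons x.1 e) := by
  rw [← (Equiv.embeddingFinSucc k α).symm.sum_comp (fun e => F e), Fintype.sum_sigma]
  simp only [Equiv.coe_embeddingFinSucc_symm]

open Classical in
theorem sum_eq_sum_range_embedding {α : Type*} [Fintype α] {k : ℕ} (e : Fin k ↪ α) (F : α → ℕ) :
    ∑ x, F x = ∑ j, F (e j) + ∑ x : {x // x ∉ Set.range e}, F x.1 := by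
  rw [← Fintype.sum_subtype_add_sum_subtype (fun x => x ∈ Set.range e) F]
  congr 1
  convert ((Equiv.ofInjective e e.injective).sum_comp (fun x => F x.1)).symm
  rfl

/-- A function is, in exactly one way, a restricted growth map followed by an injection. -/
theorem sum_eq_sum_growthMaps {α : Type*} [Fintype α] : ∀ (m : ℕ) (G : (Fin m → α) → ℕ),
    ∑ f, G f = ∑ k ∈ Finset.range (m + 1),
      ((growthMaps m k).map fun w => ∑ e : Fin k ↪ α, G (e ∘ w)).sum
  | 0, G => by
      simp [growthMaps, Subsingleton.elim _ (default : Fin 0 → α)]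
  | m + 1, G => by
      classical
      have h1 : ∑ f, G f = ∑ f : Fin m → α, ∑ x, G (Fin.cons x f) := by
        rw [← (Fin.consEquiv fun _ => α).sum_comp, Fintype.sum_prod_type_right]
        rfl
      -- The value `x` at the new index either is already taken, so the index joins block `j`, or is
      -- fresh, so the index opens a block labelled `0`: the two branches of `growthMaps`.
      have h2 : ∀ (k : ℕ) (w : Fin m → Fin k),
          ∑ e : Fin k ↪ α, ∑ x, G (Fin.cons x (e ∘ w)) =
            ((List.finRange k).map fun j =>
                ∑ e : Fin k ↪ α, G (e ∘ (Fin.cons j w : Fin (m + 1) → Fin k))).sum +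
              ∑ e : Fin (k + 1) ↪ α,
                G (e ∘ (Fin.cons 0 (Fin.succ ∘ w) : Fin (m + 1) → Fin (k + 1))) := by
        intro k w
        rw [sum_embedding_succ k fun e =>
          G (e ∘ (Fin.cons 0 (Fin.succ ∘ w) : Fin (m + 1) → Fin (k + 1)))]
        rw [Finset.sum_congr rfl fun e _ =>
          sum_eq_sum_range_embedding e fun x => G (Fin.cons x (e ∘ w)), Finset.sum_add_distrib]
        congr 1
        · rw [Finset.sum_comm, ← List.ofFn_eq_map, List.sum_ofFn]
          refine Finset.sum_congr rfl fun j _ => Finset.sum_congr rfl fun e _ => ?_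
          rw [Fin.comp_cons]
        · refine Finset.sum_congr rfl fun e _ => Finset.sum_congr rfl fun x _ => ?_
          rw [Fin.comp_cons]
          rfl
      rw [h1, sum_eq_sum_growthMaps m, Finset.sum_range_succ' _ (m + 1)]
      simp only [h2, List.sum_map_add, Finset.sum_add_distrib]
      rw [Finset.sum_range_succ']
      have h3 : ((growthMaps m 0).map fun w => ((List.finRange 0).map fun j =>
          ∑ e : Fin 0 ↪ α, G (e ∘ (Fin.cons j w : Fin (m + 1) → Fin 0))).sum).sum = 0 := by
        simp
      rw [h3]
      simp only [growthMaps, List.map_append, List.sum_append, Finset.sum_add_distrib,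
        List.map_nil, List.sum_nil, add_zero]
      congr 1
      -- The shifted sum has one extra top term, empty because `m` points cannot form `m + 1`
      -- blocks.
      · rw [Finset.sum_range_succ, growthMaps_eq_nil (Nat.lt_succ_self m)]
        simp [List.flatMap, List.map_flatten, List.sum_flatten, Function.comp_def]
      · simp [Function.comp_def]

/-! ### Separation and its invariance under relabelling -/

/-- The pair of functions `f, g` separates the points of its domain. -/
def SeparatesPoints {ι α β : Type*} (f : ι → α) (g : ι → β) : Prop :=
  ∀ i j, f i = f j → g i = g j → i = j

theorem separatesPoints_comm {ι α β : Type*} {f : ι → α} {g : ι → β} :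
    SeparatesPoints f g ↔ SeparatesPoints g f :=
  ⟨fun h i j hg hf => h i j hf hg, fun h i j hf hg => h i j hg hf⟩

theorem separatesPoints_comp_left {ι α β γ : Type*} (e : γ ↪ α) {f : ι → γ} {g : ι → β} :
    SeparatesPoints (e ∘ f) g ↔ SeparatesPoints f g := by
  simp [SeparatesPoints]

/-- Any two of the three functions separate points. -/
def PairwiseSeparates {ι α β γ : Type*} (f : ι → α) (g : ι → β) (h : ι → γ) : Prop :=
  SeparatesPoints f g ∧ SeparatesPoints f h ∧ SeparatesPoints g h

open Classical in
/-- The indicator function of `PairwiseSeparates`. -/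
noncomputable def separationIndicator {ι α β γ : Type*} (f : ι → α) (g : ι → β) (h : ι → γ) : ℕ :=
  if PairwiseSeparates f g h then 1 else 0

section separationIndicator

variable {ι α β γ δ : Type*}

theorem separationIndicator_comm_left (f : ι → α) (g : ι → β) (h : ι → γ) :
    separationIndicator f g h = separationIndicator g f h := by
  classical
  exact if_congr ⟨fun ⟨h1, h2, h3⟩ => ⟨separatesPoints_comm.1 h1, h3, h2⟩,
    fun ⟨h1, h2, h3⟩ => ⟨separatesPoints_comm.1 h1, h3, h2⟩⟩ rfl rfl

theorem separationIndicator_comm_right (f : ι → α) (g : ι → β) (h : ι → γ) :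
    separationIndicator f g h = separationIndicator f h g := by
  classical
  exact if_congr ⟨fun ⟨h1, h2, h3⟩ => ⟨h2, h1, separatesPoints_comm.1 h3⟩,
    fun ⟨h1, h2, h3⟩ => ⟨h2, h1, separatesPoints_comm.1 h3⟩⟩ rfl rfl

/-- An injection neither creates nor removes collisions; this lets the injective factor be summed
out. -/
theorem separationIndicator_comp_left (e : δ ↪ α) (f : ι → δ) (g : ι → β) (h : ι → γ) :
    separationIndicator (e ∘ f) g h = separationIndicator f g h := by
  classical
  exact if_congr (by simp only [PairwiseSeparates, separatesPoints_comp_left]) rfl rfl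

theorem separationIndicator_comp_middle (e : δ ↪ β) (f : ι → α) (g : ι → δ) (h : ι → γ) :
    separationIndicator f (e ∘ g) h = separationIndicator f g h := by
  rw [separationIndicator_comm_left, separationIndicator_comp_left, separationIndicator_comm_left]

theorem separationIndicator_comp_right (e : δ ↪ γ) (f : ι → α) (g : ι → β) (h : ι → δ) :
    separationIndicator f g (e ∘ h) = separationIndicator f g h := by
  rw [separationIndicator_comm_right, separationIndicator_comp_middle,
    separationIndicator_comm_right]

end separationIndicator

/-! ### Collisions as bit masks -/

/-- The pairs `i < j` with `w i = w j`, as the bits of a natural number. -/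
def collisionMask {m k : ℕ} (w : Fin m → Fin k) : ℕ :=
  Nat.ofBits (n := m * m) fun p => decide (p.divNat < p.modNat) && decide (w p.divNat = w p.modNat)

/-- Separation fails exactly when some pair `i < j` is identified by both maps, that is, when the
masks share a bit. -/
theorem separatesPoints_iff_land_eq_zero {m k l : ℕ} (v : Fin m → Fin k) (w : Fin m → Fin l) :
    SeparatesPoints v w ↔ collisionMask v &&& collisionMask w = 0 := by
  have key : (∀ i j : Fin m, i < j → v i = v j → w i ≠ w j) ↔
      collisionMask v &&& collisionMask w = 0 := by
    constructor
    · intro h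
      refine Nat.eq_of_testBit_eq fun b => ?_
      simp only [collisionMask, Nat.testBit_and, Nat.testBit_ofBits, Nat.zero_testBit]
      split_ifs with hb
      · by_contra hc
        simp only [Bool.not_eq_false, Bool.and_eq_true, decide_eq_true_eq] at hc
        exact h _ _ hc.1.1 hc.1.2 hc.2.2
      · rfl
    · intro h i j hij hv hw
      have h1 := congrArg (fun x => x.testBit (finProdFinEquiv (i, j)).1) h
      have h2 : (finProdFinEquiv (i, j)).divNat = i :=
        congrArg Prod.fst (finProdFinEquiv.symm_apply_apply (i, j))
      have h3 : (finProdFinEquiv (i, j)).modNat = j :=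
        congrArg Prod.snd (finProdFinEquiv.symm_apply_apply (i, j))
      simp only [collisionMask, Nat.testBit_and, Nat.testBit_ofBits, Nat.zero_testBit,
        Fin.is_lt, dite_true, Fin.eta, h2, h3] at h1
      simp [hij, hv, hw] at h1
  rw [← key]
  constructor
  · intro h i j hij hv hw
    exact hij.ne (h i j hv hw)
  · intro h i j hv hw
    rcases lt_trichotomy i j with hij | hij | hij
    · exact absurd hw (h i j hij hv)
    · exact hij
    · exact absurd hw.symm (h j i hij hv.symm)

/-! ### Expansion in falling factorials -/

theorem List.sum_map_finset_sum {ι κ : Type*} (l : List ι) (s : Finset κ) (F : κ → ι → ℕ) :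
    (l.map fun x => ∑ b ∈ s, F b x).sum = ∑ b ∈ s, (l.map (F b)).sum := by
  induction l with
  | nil => simp
  | cons x l ih => simp [ih, Finset.sum_add_distrib]

theorem List.sum_map_sum_map_comm {ι κ : Type*} (l : List ι) (l' : List κ) (F : ι → κ → ℕ) :
    (l.map fun x => (l'.map fun y => F x y).sum).sum =
      (l'.map fun y => (l.map fun x => F x y).sum).sum := by
  induction l with
  | nil => simp
  | cons x l ih => simp [ih, List.sum_map_add]

theorem sum_eq_sum_descFactorial {α : Type*} [Fintype α] (m : ℕ) (G : (Fin m → α) → ℕ)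
    (H : ∀ k, (Fin m → Fin k) → ℕ)
    (hGH : ∀ k (e : Fin k ↪ α) (w : Fin m → Fin k), G (e ∘ w) = H k w) :
    ∑ f, G f = ∑ k ∈ Finset.range (m + 1),
      ((growthMaps m k).map (H k)).sum * (Fintype.card α).descFactorial k := by
  classical
  rw [sum_eq_sum_growthMaps]
  refine Finset.sum_congr rfl fun k _ => ?_
  rw [← List.sum_map_mul_right]
  simp [hGH, Finset.card_univ, Fintype.card_embedding_eq, mul_comm]

/-- The number of triples of restricted growth maps with `a`, `b` and `c` blocks that pairwise
separate points. -/
noncomputable def separatingCount (m a b c : ℕ) : ℕ :=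
  ((growthMaps m a).map fun u => ((growthMaps m b).map fun v => ((growthMaps m c).map fun w =>
    separationIndicator u v w).sum).sum).sum

theorem separatingCount_comm_left (m a b c : ℕ) :
    separatingCount m a b c = separatingCount m b a c := by
  unfold separatingCount
  rw [List.sum_map_sum_map_comm]
  simp only [separationIndicator_comm_left (α := Fin a)]

theorem separatingCount_comm_right (m a b c : ℕ) :
    separatingCount m a b c = separatingCount m a c b := by
  unfold separatingCount
  simp only [List.sum_map_sum_map_comm (growthMaps m b) (growthMaps m c),
    separationIndicator_comm_right (β := Fin b) (γ := Fin c)]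

theorem sum_pairwiseSeparates (m r s n : ℕ) :
    (∑ f : Fin m → Fin r, ∑ g : Fin m → Fin s, ∑ h : Fin m → Fin n,
      separationIndicator f g h) =
    ∑ a ∈ Finset.range (m + 1), (∑ b ∈ Finset.range (m + 1), (∑ c ∈ Finset.range (m + 1),
      separatingCount m a b c * n.descFactorial c) * s.descFactorial b) * r.descFactorial a := by
  rw [sum_eq_sum_descFactorial m _ (fun a u => ∑ g : Fin m → Fin s, ∑ h : Fin m → Fin n,
      separationIndicator u g h)
    fun k e w => by simp only [separationIndicator_comp_left]]
  simp only [Fintype.card_fin]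
  refine Finset.sum_congr rfl fun a _ => ?_
  congr 1
  simp only [separatingCount, ← List.sum_map_mul_right, ← List.sum_map_finset_sum]
  congr 1
  refine List.map_congr_left fun u _ => ?_
  rw [sum_eq_sum_descFactorial m _ (fun b v => ∑ h : Fin m → Fin n,
      separationIndicator u v h)
    fun k e w => by simp only [separationIndicator_comp_middle]]
  simp only [Fintype.card_fin]
  refine Finset.sum_congr rfl fun b _ => ?_
  rw [← List.sum_map_mul_right]
  congr 1
  refine List.map_congr_left fun v _ => ?_
  congr 1
  rw [sum_eq_sum_descFactorial m _ (fun c w => separationIndicator u v w)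
    fun k e w => by simp only [separationIndicator_comp_right]]
  simp only [Fintype.card_fin, ← List.sum_map_mul_right]

/-! ### Counting disjoint masks by kernel evaluation -/

/-- The number of `z ∈ l` whose bits are disjoint from those of `u`. -/
def countDisjoint (u : ℕ) (l : List ℕ) : ℕ :=
  List.rec 0 (fun z _ ih => Nat.add (Nat.sub 1 (Nat.land u z)) ih) l

/-- The number of `(y, z) ∈ Y × Z` such that `x`, `y`, `z` have pairwise disjoint bits. -/
def countDisjointPairs (x : ℕ) (Y Z : List ℕ) : ℕ :=
  List.rec 0 (fun y _ ih => bif Nat.beq (Nat.land x y) 0 then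
    Nat.add (countDisjoint (Nat.lor x y) Z) ih else ih) Y

/-- The number of `(x, y, z) ∈ X × Y × Z` with pairwise disjoint bits. -/
def countDisjointTriples (X Y Z : List ℕ) : ℕ :=
  List.rec 0 (fun x _ ih => Nat.add (countDisjointPairs x Y Z) ih) X

/-- Truncated subtraction `1 - t` is the indicator of `t = 0`. -/
theorem countDisjoint_eq (u : ℕ) (l : List ℕ) :
    countDisjoint u l = (l.map fun z => if u &&& z = 0 then 1 else 0).sum := by
  induction l with
  | nil => rfl
  | cons z l ih =>
    rw [List.map_cons, List.sum_cons, ← ih]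
    change 1 - (u &&& z) + countDisjoint u l = _
    congr 1
    split_ifs <;> omega

/-- Being disjoint from both `x` and `y` is being disjoint from `x ||| y`, so one test per `z`
suffices. -/
theorem countDisjointPairs_eq (x : ℕ) (Y Z : List ℕ) :
    countDisjointPairs x Y Z = (Y.map fun y => (Z.map fun z =>
      if x &&& y = 0 ∧ x &&& z = 0 ∧ y &&& z = 0 then 1 else 0).sum).sum := by
  induction Y with
  | nil => rfl
  | cons y Y ih =>
    rw [List.map_cons, List.sum_cons, ← ih]
    change (bif (x &&& y).beq 0 then countDisjoint (x ||| y) Z + countDisjointPairs x Y Z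
      else countDisjointPairs x Y Z) = _
    by_cases h : x &&& y = 0
    · simp [h, countDisjoint_eq, Nat.and_or_distrib_right, Nat.or_eq_zero_iff]
    · have h' : (x &&& y).beq 0 = false := by
        rw [← Bool.not_eq_true, Nat.beq_eq]; exact h
      simp [h, h']

theorem countDisjointTriples_eq (X Y Z : List ℕ) :
    countDisjointTriples X Y Z = (X.map fun x => (Y.map fun y => (Z.map fun z =>
      if x &&& y = 0 ∧ x &&& z = 0 ∧ y &&& z = 0 then 1 else 0).sum).sum).sum := by
  induction X with
  | nil => rfl
  | cons x X ih =>
    rw [List.map_cons, List.sum_cons, ← ih, ← countDisjointPairs_eq]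
    rfl

theorem separatingCount_eq (m a b c : ℕ) :
    separatingCount m a b c = countDisjointTriples ((growthMaps m a).map collisionMask)
      ((growthMaps m b).map collisionMask) ((growthMaps m c).map collisionMask) := by
  have h : ∀ (u : Fin m → Fin a) (v : Fin m → Fin b) (w : Fin m → Fin c),
      separationIndicator u v w = if collisionMask u &&& collisionMask v = 0 ∧
        collisionMask u &&& collisionMask w = 0 ∧ collisionMask v &&& collisionMask w = 0
        then 1 else 0 := fun u v w => by
    classical
    exact if_congr (by simp only [PairwiseSeparates, separatesPoints_iff_land_eq_zero]) rfl rfl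
  simp only [separatingCount, h, countDisjointTriples_eq, List.map_map, Function.comp_def]

theorem card_separating_triples (m r s n : ℕ) :
    Nat.card {t : Fin m → Fin r × Fin s × Fin n // PairwiseSeparates (fun i => (t i).1)
      (fun i => (t i).2.1) (fun i => (t i).2.2)} =
    ∑ a ∈ Finset.range (m + 1), (∑ b ∈ Finset.range (m + 1), (∑ c ∈ Finset.range (m + 1),
      separatingCount m a b c * n.descFactorial c) * s.descFactorial b) * r.descFactorial a := by
  classical
  have h0 : ∀ (f : Fin m → Fin r) (g : Fin m → Fin s) (h : Fin m → Fin n),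
      separationIndicator f g h = if PairwiseSeparates f g h then 1 else 0 := fun f g h =>
    if_congr Iff.rfl rfl rfl
  simp only [← sum_pairwiseSeparates, h0]
  rw [ Nat.card_eq_fintype_card, Fintype.card_subtype,
    Finset.card_filter]
  let e : (Fin m → Fin r × Fin s × Fin n) ≃ (Fin m → Fin r) × (Fin m → Fin s) × (Fin m → Fin n) :=
    (Equiv.arrowProdEquivProdArrow _ _ _).trans
      (Equiv.prodCongr (Equiv.refl _) (Equiv.arrowProdEquivProdArrow _ _ _))
  rw [← e.symm.sum_comp, Fintype.sum_prod_type]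
  simp only [Fintype.sum_prod_type]
  rfl

/-! ### Rectangles with numbered cells as tuples of triples -/

/-- The non-empty cells of an array. -/
abbrev FilledCell {r s n : ℕ} (P : Fin r → Fin s → Option (Fin n)) : Type :=
  {c : Fin r × Fin s // (P c.1 c.2).isSome = true}

/-- The tuple of entries of an array at an enumeration of its non-empty cells. -/
def entries {r s n m : ℕ} (P : Fin r → Fin s → Option (Fin n)) (e : Fin m ↪ FilledCell P)
    (i : Fin m) : Fin r × Fin s × Fin n :=
  ((e i).1.1, (e i).1.2, (P (e i).1.1 (e i).1.2).get (e i).2)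

theorem apply_entries {r s n m : ℕ} (P : Fin r → Fin s → Option (Fin n)) (e : Fin m ↪ FilledCell P)
    (i : Fin m) : P (entries P e i).1 (entries P e i).2.1 = some (entries P e i).2.2 := by
  simp [entries]

/-- Row and column separate because the numbered cells are distinct; the two Latin conditions reduce
the other two pairs to this one. -/
theorem pairwiseSeparates_entries {r s n m : ℕ} {P : Fin r → Fin s → Option (Fin n)}
    (hP : IsPartialLatinRectangle P) (e : Fin m ↪ FilledCell P) :
    PairwiseSeparates (fun i => (entries P e i).1) (fun i => (entries P e i).2.1)
      (fun i => (entries P e i).2.2) := by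
  have key : SeparatesPoints (fun i => (entries P e i).1) (fun i => (entries P e i).2.1) :=
    fun i j h1 h2 => e.injective (Subtype.ext (Prod.ext h1 h2))
  refine ⟨key, fun i j h1 h3 => key i j h1 ?_, fun i j h2 h3 => key i j ?_ h2⟩
  · have hi := apply_entries P e i
    have hj := apply_entries P e j
    simp only at h1 h3
    rw [h1, h3] at hi
    exact hP.1 _ _ _ _ hi hj
  · have hi := apply_entries P e i
    have hj := apply_entries P e j
    simp only at h2 h3
    rw [h2, h3] at hi
    exact hP.2 _ _ _ _ hi hj

theorem entries_surjective {r s n m : ℕ} {P : Fin r → Fin s → Option (Fin n)}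
    (hP : arraySize P = m) (e : Fin m ↪ FilledCell P) : Function.Surjective e := by
  refine ((Fintype.bijective_iff_injective_and_card e).2 ⟨e.injective, ?_⟩).2
  rw [Fintype.card_fin, Fintype.card_subtype, ← hP, arraySize]

theorem eq_some_iff_exists_entries {r s n m : ℕ} {P : Fin r → Fin s → Option (Fin n)}
    (hP : arraySize P = m) (e : Fin m ↪ FilledCell P) (x : Fin r) (y : Fin s) (z : Fin n) :
    P x y = some z ↔ ∃ i, entries P e i = (x, y, z) := by
  constructor
  · intro h
    obtain ⟨i, hi⟩ := entries_surjective hP e ⟨(x, y), by simp [h]⟩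
    exact ⟨i, by simp [entries, hi, h]⟩
  · rintro ⟨i, hi⟩
    simpa [hi] using apply_entries P e i

theorem entries_bijective (r s n m : ℕ) : Function.Bijective
    (fun p : Σ P : partialLatinRectangles r s n m, (Fin m ↪ FilledCell P.1) =>
      (⟨entries p.1.1 p.2, pairwiseSeparates_entries p.1.2.1 p.2⟩ :
        {t : Fin m → Fin r × Fin s × Fin n // PairwiseSeparates (fun i => (t i).1)
          (fun i => (t i).2.1) (fun i => (t i).2.2)})) := by
  classical
  constructor
  · rintro ⟨⟨P, hP⟩, e⟩ ⟨⟨Q, hQ⟩, d⟩ h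
    have h' : entries P e = entries Q d := congrArg Subtype.val h
    -- The tuple lists all filled cells with their symbols, so it determines the array.
    have hPQ : P = Q := by
      funext x y
      refine Option.ext fun z => ?_
      rw [eq_some_iff_exists_entries hP.2 e, eq_some_iff_exists_entries hQ.2 d, h']
    subst hPQ
    have hed : e = d := by
      ext i : 2
      exact Prod.ext (congrArg (fun t => (t i).1) h') (congrArg (fun t => (t i).2.1) h')
    rw [hed]
  · rintro ⟨t, ht12, ht13, ht23⟩
    let P : Fin r → Fin s → Option (Fin n) := fun x y =>
      if h : ∃ i, (t i).1 = x ∧ (t i).2.1 = y then some (t h.choose).2.2 else none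
    have hP : ∀ x y z, P x y = some z ↔ ∃ i, t i = (x, y, z) := by
      intro x y z
      by_cases h : ∃ i, (t i).1 = x ∧ (t i).2.1 = y
      · have hc := h.choose_spec
        simp only [P, dif_pos h, Option.some.injEq]
        constructor
        · intro hz
          exact ⟨h.choose, Prod.ext hc.1 (Prod.ext hc.2 hz)⟩
        · rintro ⟨i, hi⟩
          -- Row and column separate, so at most one index sits at each cell and the choice is
          -- forced.
          have : h.choose = i := ht12 _ _ (by simp [hc.1, hi]) (by simp [hc.2, hi])
          rw [this, hi]
      · simp only [P, dif_neg h, reduceCtorEq, false_iff]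
        rintro ⟨i, hi⟩
        exact h ⟨i, by simp [hi], by simp [hi]⟩
    have ht : ∀ i, P (t i).1 (t i).2.1 = some (t i).2.2 := fun i => (hP _ _ _).2 ⟨i, rfl⟩
    let e : Fin m ↪ FilledCell P :=
      ⟨fun i => ⟨((t i).1, (t i).2.1), by simp [ht]⟩, fun i j hij => by
        have h : ((t i).1, (t i).2.1) = ((t j).1, (t j).2.1) := congrArg Subtype.val hij
        exact ht12 i j (Prod.mk.inj h).1 (Prod.mk.inj h).2⟩
    have he : Function.Surjective e := by
      rintro ⟨⟨x, y⟩, hxy⟩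
      obtain ⟨z, hz⟩ := Option.isSome_iff_exists.1 hxy
      obtain ⟨i, hi⟩ := (hP x y z).1 hz
      refine ⟨i, Subtype.ext ?_⟩
      change ((t i).1, (t i).2.1) = (x, y)
      rw [hi]
    have hlatin : IsPartialLatinRectangle P := by
      constructor
      · intro x y y' z h h'
        obtain ⟨i, hi⟩ := (hP _ _ _).1 h
        obtain ⟨j, hj⟩ := (hP _ _ _).1 h'
        have hij : i = j := ht13 i j (by simp [hi, hj]) (by simp [hi, hj])
        rw [hij, hj] at hi
        simpa using hi.symm
      · intro x x' y z h h'
        obtain ⟨i, hi⟩ := (hP _ _ _).1 h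
        obtain ⟨j, hj⟩ := (hP _ _ _).1 h'
        have hij : i = j := ht23 i j (by simp [hi, hj]) (by simp [hi, hj])
        rw [hij, hj] at hi
        simpa using hi.symm
    have hsize : arraySize P = m := by
      have := Fintype.card_of_bijective ⟨e.injective, he⟩
      rw [Fintype.card_fin, Fintype.card_subtype] at this
      rw [arraySize, this]
    refine ⟨⟨⟨P, hlatin, hsize⟩, e⟩, Subtype.ext (funext fun i => ?_)⟩
    have := apply_entries P e i
    exact Prod.ext rfl (Prod.ext rfl (Option.some.inj (this.symm.trans (ht i))))

theorem factorial_mul_ncard (r s n m : ℕ) :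
    m.factorial * (partialLatinRectangles r s n m).ncard =
    ∑ a ∈ Finset.range (m + 1), (∑ b ∈ Finset.range (m + 1), (∑ c ∈ Finset.range (m + 1),
      separatingCount m a b c * n.descFactorial c) * s.descFactorial b) * r.descFactorial a := by
  classical
  rw [← card_separating_triples, ← Nat.card_eq_of_bijective _ (entries_bijective r s n m),
    Nat.card_sigma, mul_comm, ← Nat.card_coe_set_eq]
  have h : ∀ P : partialLatinRectangles r s n m,
      Nat.card (Fin m ↪ FilledCell P.1) = m.factorial := by
    rintro ⟨P, _, hP⟩
    have hc : Fintype.card (FilledCell P) = m := by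
      rw [Fintype.card_subtype, ← hP, arraySize]
    rw [Nat.card_eq_fintype_card, Fintype.card_embedding_eq, hc, Fintype.card_fin,
      Nat.descFactorial_self]
  simp only [h, Finset.sum_const, smul_eq_mul, Finset.card_univ, Nat.card_eq_fintype_card]

/-! ### Tables of masks; the pair `(i, j)` is bit `m * i + j` -/

theorem map_collisionMask_growthMaps_1_1 :
    (growthMaps 1 1).map collisionMask =
      [0] := by
  decide +kernel

theorem map_collisionMask_growthMaps_2_1 :
    (growthMaps 2 1).map collisionMask =
      [2] := by
  decide +kernel

theorem map_collisionMask_growthMaps_2_2 :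
    (growthMaps 2 2).map collisionMask =
      [0] := by
  decide +kernel

theorem map_collisionMask_growthMaps_3_1 :
    (growthMaps 3 1).map collisionMask =
      [38] := by
  decide +kernel

theorem map_collisionMask_growthMaps_3_2 :
    (growthMaps 3 2).map collisionMask =
      [2, 4, 32] := by
  decide +kernel

theorem map_collisionMask_growthMaps_3_3 :
    (growthMaps 3 3).map collisionMask =
      [0] := by
  decide +kernel

theorem map_collisionMask_growthMaps_4_1 :
    (growthMaps 4 1).map collisionMask =
      [2254] := by
  decide +kernel

theorem map_collisionMask_growthMaps_4_2 :
    (growthMaps 4 2).map collisionMask =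
      [70, 72, 132, 138, 2050, 2060, 2240] := by
  decide +kernel

theorem map_collisionMask_growthMaps_4_3 :
    (growthMaps 4 3).map collisionMask =
      [2, 4, 8, 64, 128, 2048] := by
  decide +kernel

theorem map_collisionMask_growthMaps_4_4 :
    (growthMaps 4 4).map collisionMask =
      [0] := by
  decide +kernel

theorem map_collisionMask_growthMaps_5_1 :
    (growthMaps 5 1).map collisionMask =
      [549790] := by
  decide +kernel

theorem map_collisionMask_growthMaps_5_2 :
    (growthMaps 5 2).map collisionMask =
      [8590, 8592, 8716, 8722, 16650, 16660, 17032, 17046, 524422, 524440, 525060, 525082, 548866,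
        548892, 549760] := by
  decide +kernel

theorem map_collisionMask_growthMaps_5_3 :
    (growthMaps 5 3).map collisionMask =
      [134, 136, 144, 260, 266, 272, 516, 520, 530, 8194, 8204, 8208, 16386, 16392, 16404, 524290,
        524292, 524312, 8576, 8704, 16640, 17024, 524416, 525056, 548864] := by
  decide +kernel

theorem map_collisionMask_growthMaps_5_4 :
    (growthMaps 5 4).map collisionMask =
      [2, 4, 8, 16, 128, 256, 512, 8192, 16384, 524288] := by
  decide +kernel

theorem map_collisionMask_growthMaps_5_5 :
    (growthMaps 5 5).map collisionMask =
      [0] := by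
  decide +kernel

theorem map_collisionMask_growthMaps_6_1 :
    (growthMaps 6 1).map collisionMask =
      [549687102] := by
  decide +kernel

theorem map_collisionMask_growthMaps_6_2 :
    (growthMaps 6 2).map collisionMask =
      [4294430, 4294432, 4294684, 4294690, 4326938, 4326948, 4327704, 4327718, 8455446, 8455464,
        8456724, 8456746, 8553490, 8553516, 8555280, 8555310, 536904462, 536904496, 536906764,
        536906802, 537068042, 537068084, 537070856, 537070902, 549454086, 549454136, 549457412,
        549457466, 549683202, 549683260, 549687040] := by
  decide +kernel

theorem map_collisionMask_growthMaps_6_3 :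
    (growthMaps 6 3).map collisionMask =
      [33550, 33552, 33568, 33804, 33810, 33824, 34828, 34832, 34850, 66058, 66068, 66080, 66824,
        66838, 66848, 67592, 67604, 67618, 131594, 131600, 131620, 132104, 132114, 132132, 133384,
        133392, 133414, 4194566, 4194584, 4194592, 4195844, 4195866, 4195872, 4196356, 4196376,
        4196386, 8388870, 8388880, 8388904, 8389636, 8389650, 8389672, 8391172, 8391184, 8391210,
        536871174, 536871176, 536871216, 536871428, 536871434, 536871472, 536873988, 536873992,
        536874034, 4292610, 4292636, 4292640, 4325378, 4325400, 4325412, 8454146, 8454164,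
        8454184, 8552450, 8552464, 8552492, 536903682, 536903692, 536903728, 537067522, 537067528,
        537067572, 549453826, 549453828, 549453880, 4294400, 4294656, 4326912, 4327680, 8455424,
        8456704, 8553472, 8555264, 536904448, 536906752, 537068032, 537070848, 549454080,
        549457408, 549683200] := by
  decide +kernel

theorem map_collisionMask_growthMaps_6_4 :
    (growthMaps 6 4).map collisionMask =
      [262, 264, 272, 288, 516, 522, 528, 544, 1028, 1032, 1042, 1056, 2052, 2056, 2064, 2082,
        32770, 32780, 32784, 32800, 65538, 65544, 65556, 65568, 131074, 131080, 131088, 131108,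
        4194306, 4194308, 4194328, 4194336, 8388610, 8388612, 8388624, 8388648, 536870914,
        536870916, 536870920, 536870960, 33536, 33792, 34816, 66048, 66816, 67584, 131584, 132096,
        133376, 4194560, 4195840, 4196352, 8388864, 8389632, 8391168, 536871168, 536871424,
        536873984, 4292608, 4325376, 8454144, 8552448, 536903680, 537067520, 549453824] := by
  decide +kernel

theorem map_collisionMask_growthMaps_6_5 :
    (growthMaps 6 5).map collisionMask =
      [2, 4, 8, 16, 32, 256, 512, 1024, 2048, 32768, 65536, 131072, 4194304, 8388608,
        536870912] := by
  decide +kernel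

theorem map_collisionMask_growthMaps_6_6 :
    (growthMaps 6 6).map collisionMask =
      [0] := by
  decide +kernel

/-! ### Values of the separating counts -/

theorem SeparatesPoints.card_le {m a b : ℕ} {u : Fin m → Fin a} {v : Fin m → Fin b}
    (h : SeparatesPoints u v) : m ≤ a * b := by
  have hinj : Function.Injective fun i => (u i, v i) := fun i j hij =>
    h i j (Prod.mk.inj hij).1 (Prod.mk.inj hij).2
  simpa using Fintype.card_le_of_injective _ hinj

theorem separatingCount_eq_zero {m a b : ℕ} (hab : a * b < m) (c : ℕ) :
    separatingCount m a b c = 0 := by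
  have h : ∀ (u : Fin m → Fin a) (v : Fin m → Fin b) (w : Fin m → Fin c),
      separationIndicator u v w = 0 := fun u v w =>
    if_neg fun huvw => hab.not_ge huvw.1.card_le
  simp [separatingCount, h]

/-- Here and below, only `a ≤ b ≤ c` with `m ≤ a * b` are needed: symmetry and
`separatingCount_eq_zero` give the rest. -/
theorem separatingCount_one :
    separatingCount 1 1 1 1 = 1 := by
  simp only [separatingCount_eq, map_collisionMask_growthMaps_1_1]
  decide +kernel

theorem separatingCount_two :
    separatingCount 2 1 2 2 = 1 ∧ separatingCount 2 2 2 2 = 1 := by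
  simp only [separatingCount_eq, map_collisionMask_growthMaps_2_1,
    map_collisionMask_growthMaps_2_2]
  decide +kernel

theorem separatingCount_three :
    separatingCount 3 1 3 3 = 1 ∧ separatingCount 3 2 2 2 = 6 ∧
    separatingCount 3 2 2 3 = 6 ∧ separatingCount 3 2 3 3 = 3 ∧
    separatingCount 3 3 3 3 = 1 := by
  simp only [separatingCount_eq, map_collisionMask_growthMaps_3_1,
    map_collisionMask_growthMaps_3_2,
    map_collisionMask_growthMaps_3_3]
  decide +kernel

theorem separatingCount_four :
    separatingCount 4 1 4 4 = 1 ∧ separatingCount 4 2 2 2 = 6 ∧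
    separatingCount 4 2 2 3 = 12 ∧ separatingCount 4 2 2 4 = 6 ∧
    separatingCount 4 2 3 3 = 60 ∧ separatingCount 4 2 3 4 = 24 ∧
    separatingCount 4 2 4 4 = 7 ∧ separatingCount 4 3 3 3 = 120 ∧
    separatingCount 4 3 3 4 = 30 ∧ separatingCount 4 3 4 4 = 6 ∧
    separatingCount 4 4 4 4 = 1 := by
  simp only [separatingCount_eq, map_collisionMask_growthMaps_4_1,
    map_collisionMask_growthMaps_4_2,
    map_collisionMask_growthMaps_4_3,
    map_collisionMask_growthMaps_4_4]
  decide +kernel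

theorem separatingCount_five :
    separatingCount 5 1 5 5 = 1 ∧ separatingCount 5 2 3 3 = 180 ∧
    separatingCount 5 2 3 4 = 240 ∧ separatingCount 5 2 3 5 = 60 ∧
    separatingCount 5 2 4 4 = 360 ∧ separatingCount 5 2 4 5 = 80 ∧
    separatingCount 5 2 5 5 = 15 ∧ separatingCount 5 3 3 3 = 1590 ∧
    separatingCount 5 3 3 4 = 1620 ∧ separatingCount 5 3 3 5 = 300 ∧
    separatingCount 5 3 4 4 = 1260 ∧ separatingCount 5 3 4 5 = 190 ∧
    separatingCount 5 3 5 5 = 25 ∧ separatingCount 5 4 4 4 = 720 ∧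
    separatingCount 5 4 4 5 = 90 ∧ separatingCount 5 4 5 5 = 10 ∧
    separatingCount 5 5 5 5 = 1 := by
  simp only [separatingCount_eq, map_collisionMask_growthMaps_5_1,
    map_collisionMask_growthMaps_5_2,
    map_collisionMask_growthMaps_5_3,
    map_collisionMask_growthMaps_5_4,
    map_collisionMask_growthMaps_5_5]
  decide +kernel

theorem separatingCount_six :
    separatingCount 6 1 6 6 = 1 ∧ separatingCount 6 2 3 3 = 120 ∧
    separatingCount 6 2 3 4 = 540 ∧ separatingCount 6 2 3 5 = 360 ∧
    separatingCount 6 2 3 6 = 60 ∧ separatingCount 6 2 4 4 = 3240 ∧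
    separatingCount 6 2 4 5 = 2340 ∧ separatingCount 6 2 4 6 = 360 ∧
    separatingCount 6 2 5 5 = 1680 ∧ separatingCount 6 2 5 6 = 240 ∧
    separatingCount 6 2 6 6 = 31 ∧ separatingCount 6 3 3 3 = 7680 ∧
    separatingCount 6 3 3 4 = 21120 ∧ separatingCount 6 3 3 5 = 11880 ∧
    separatingCount 6 3 3 6 = 1560 ∧ separatingCount 6 3 4 4 = 47910 ∧
    separatingCount 6 3 4 5 = 23040 ∧ separatingCount 6 3 4 6 = 2610 ∧
    separatingCount 6 3 5 5 = 9660 ∧ separatingCount 6 3 5 6 = 975 ∧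
    separatingCount 6 3 6 6 = 90 ∧ separatingCount 6 4 4 4 = 76950 ∧
    separatingCount 6 4 4 5 = 29430 ∧ separatingCount 6 4 4 6 = 2810 ∧
    separatingCount 6 4 5 5 = 9660 ∧ separatingCount 6 4 5 6 = 825 ∧
    separatingCount 6 4 6 6 = 65 ∧ separatingCount 6 5 5 5 = 2730 ∧
    separatingCount 6 5 5 6 = 210 ∧ separatingCount 6 5 6 6 = 15 ∧
    separatingCount 6 6 6 6 = 1 := by
  simp only [separatingCount_eq, map_collisionMask_growthMaps_6_1,
    map_collisionMask_growthMaps_6_2,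
    map_collisionMask_growthMaps_6_3,
    map_collisionMask_growthMaps_6_4,
    map_collisionMask_growthMaps_6_5,
    map_collisionMask_growthMaps_6_6]
  decide +kernel

/-! ### Passage to polynomials and conclusion -/

/-- No bound on `k` is needed: for `x < k` the falling factorial on the right is already zero. -/
theorem cast_descFactorial_succ (x k : ℕ) :
    (x.descFactorial (k + 1) : ℤ) = (x - k) * x.descFactorial k := by
  rw [Nat.descFactorial_succ]
  rcases le_or_gt k x with h | h
  · push_cast [Nat.cast_sub h]; rfl
  · simp [Nat.descFactorial_of_lt h]

section symMon

variable (r s n : ℕ) {a b c : ℕ}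

/-- Coinciding rearrangements merge in the indexing `Finset`, so each equality pattern of the
exponents has its own expansion. -/
theorem symMon_self : symMon r s n a a a = (r : ℤ) ^ a * s ^ a * n ^ a := by
  simp [symMon]

theorem symMon_self_right (h : a ≠ b) : symMon r s n a b b =
    (r : ℤ) ^ a * s ^ b * n ^ b + r ^ b * s ^ a * n ^ b + r ^ b * s ^ b * n ^ a := by
  have h' := h.symm
  simp [symMon, h, h', add_assoc]

theorem symMon_self_left (h : a ≠ b) : symMon r s n a a b =
    (r : ℤ) ^ a * s ^ a * n ^ b + r ^ a * s ^ b * n ^ a + r ^ b * s ^ a * n ^ a := by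
  have h' := h.symm
  simp [symMon, h, h', add_assoc]

theorem symMon_of_ne (hab : a ≠ b) (hbc : b ≠ c) (hac : a ≠ c) : symMon r s n a b c =
    (r : ℤ) ^ a * s ^ b * n ^ c + r ^ a * s ^ c * n ^ b + r ^ b * s ^ a * n ^ c +
      r ^ b * s ^ c * n ^ a + r ^ c * s ^ a * n ^ b + r ^ c * s ^ b * n ^ a := by
  have hab' := hab.symm
  have hbc' := hbc.symm
  have hac' := hac.symm
  simp [symMon, *, add_assoc]

end symMon

theorem separatingCount_zero : separatingCount 0 0 0 0 = 1 := by
  rw [separatingCount_eq]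
  decide +kernel

set_option maxHeartbeats 4000000 in
theorem mainTheorem1 (r s n : ℕ) :
    (partialLatinRectangles r s n 0).ncard = 1 ∧
    ((partialLatinRectangles r s n 1).ncard : ℤ) =
      symMon r s n 1 1 1 ∧
    (Nat.factorial 2 : ℤ) * ((partialLatinRectangles r s n 2).ncard : ℤ) =
      symMon r s n 1 1 1 * (symMon r s n 1 1 1 - symMon r s n 1 0 0 + 2) ∧
    (Nat.factorial 3 : ℤ) * ((partialLatinRectangles r s n 3).ncard : ℤ) =
      symMon r s n 1 1 1 * (symMon r s n 2 2 2 - 3 * symMon r s n 2 1 1 + 6 *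
      (symMon r s n 1 1 1 + symMon r s n 1 1 0) + 2 * symMon r s n 2 0 0
      - 12 * symMon r s n 1 0 0 + 14) ∧
    (Nat.factorial 4 : ℤ) * ((partialLatinRectangles r s n 4).ncard : ℤ) =
      symMon r s n 1 1 1 * (symMon r s n 3 3 3 - 6 * symMon r s n 3 2 2
      + 12 * symMon r s n 2 2 2 + 11 * symMon r s n 3 1 1 + 30 * symMon r s n 2 2 1
      - 60 * symMon r s n 2 1 1 - 6 * symMon r s n 3 0 0 - 36 * symMon r s n 2 1 0
      - 28 * symMon r s n 1 1 1 + 72 * symMon r s n 2 0 0 + 198 * symMon r s n 1 1 0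
      - 228 * symMon r s n 1 0 0 + 198) ∧
    (Nat.factorial 5 : ℤ) * ((partialLatinRectangles r s n 5).ncard : ℤ) =
      symMon r s n 1 1 1 * (symMon r s n 4 4 4 - 10 * symMon r s n 4 3 3
      + 20 * symMon r s n 3 3 3 + 35 * symMon r s n 4 2 2 + 90 * symMon r s n 3 3 2
      - 180 * symMon r s n 3 2 2 - 50 * symMon r s n 4 1 1 - 260 * symMon r s n 3 2 1
      - 460 * symMon r s n 2 2 2 + 520 * symMon r s n 3 1 1 + 1350 * symMon r s n 2 2 1
      + 24 * symMon r s n 4 0 0 + 240 * symMon r s n 3 1 0 + 480 * symMon r s n 2 2 0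
      - 320 * symMon r s n 2 1 1 - 480 * symMon r s n 3 0 0 - 2520 * symMon r s n 2 1 0
      - 5090 * symMon r s n 1 1 1 + 2880 * symMon r s n 2 0 0 + 7440 * symMon r s n 1 1 0
      - 6360 * symMon r s n 1 0 0 + 4512) ∧
    (Nat.factorial 6 : ℤ) * ((partialLatinRectangles r s n 6).ncard : ℤ) =
      symMon r s n 1 1 1 * (symMon r s n 5 5 5 - 15 * symMon r s n 5 4 4
      + 30 * symMon r s n 4 4 4 + 85 * symMon r s n 5 3 3 + 210 * symMon r s n 4 4 3
      - 420 * symMon r s n 4 3 3 - 225 * symMon r s n 5 2 2 - 1065 * symMon r s n 4 3 2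
      - 2150 * symMon r s n 3 3 3 + 2130 * symMon r s n 4 2 2 + 5310 * symMon r s n 3 3 2
      + 274 * symMon r s n 5 1 1 + 2310 * symMon r s n 4 2 1 + 4400 * symMon r s n 3 3 1
      + 4800 * symMon r s n 3 2 2 - 4620 * symMon r s n 4 1 1 - 22170 * symMon r s n 3 2 1
      - 49500 * symMon r s n 2 2 2 - 120 * symMon r s n 5 0 0 - 1800 * symMon r s n 4 1 0
      - 6000 * symMon r s n 3 2 0 + 10460 * symMon r s n 3 1 1 + 34980 * symMon r s n 2 2 1
      + 3600 * symMon r s n 4 0 0 + 30600 * symMon r s n 3 1 0 + 58440 * symMon r s n 2 2 0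
      + 88710 * symMon r s n 2 1 1 - 34800 * symMon r s n 3 0 0 - 165480 * symMon r s n 2 1 0
      - 364268 * symMon r s n 1 1 1 + 140040 * symMon r s n 2 0 0
      + 344520 * symMon r s n 1 1 0 - 240720 * symMon r s n 1 0 0 + 146400) := by
  refine ⟨?_, ?_, ?_, ?_, ?_, ?_, ?_⟩
  · have h := factorial_mul_ncard r s n 0
    simpa [separatingCount_zero] using h
  · have h := factorial_mul_ncard r s n 1
    simp only [Finset.sum_range_succ, Finset.sum_range_zero] at h
    -- Ordered rewriting with the two transpositions sorts the block numbers, so that the vanishing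
    -- test sees the two smallest.
    simp only [separatingCount_comm_left, separatingCount_comm_right] at h
    simp (discharger := decide) only [separatingCount_eq_zero, separatingCount_one,
      zero_mul, add_zero, zero_add] at h
    have h' := congrArg (Nat.cast : ℕ → ℤ) h
    push_cast [cast_descFactorial_succ, Nat.descFactorial_zero] at h'
    rw [Nat.factorial_one, Nat.cast_one, one_mul] at h'
    rw [h']
    simp (discharger := decide) only [symMon_self]
    ring
  · have h := factorial_mul_ncard r s n 2
    simp only [Finset.sum_range_succ, Finset.sum_range_zero] at h
    simp only [separatingCount_comm_left, separatingCount_comm_right] at h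
    simp (discharger := decide) only [separatingCount_eq_zero, separatingCount_two,
      zero_mul, add_zero, zero_add] at h
    have h' := congrArg (Nat.cast : ℕ → ℤ) h
    push_cast [cast_descFactorial_succ, Nat.descFactorial_zero] at h'
    rw [h']
    simp (discharger := decide) only [symMon_self, symMon_self_right]
    ring
  · have h := factorial_mul_ncard r s n 3
    simp only [Finset.sum_range_succ, Finset.sum_range_zero] at h
    simp only [separatingCount_comm_left, separatingCount_comm_right] at h
    simp (discharger := decide) only [separatingCount_eq_zero, separatingCount_three,
      zero_mul, add_zero, zero_add] at h
    have h' := congrArg (Nat.cast : ℕ → ℤ) h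
    push_cast [cast_descFactorial_succ, Nat.descFactorial_zero] at h'
    rw [h']
    simp (discharger := decide) only [symMon_self, symMon_self_right, symMon_self_left]
    ring
  · have h := factorial_mul_ncard r s n 4
    simp only [Finset.sum_range_succ, Finset.sum_range_zero] at h
    simp only [separatingCount_comm_left, separatingCount_comm_right] at h
    simp (discharger := decide) only [separatingCount_eq_zero, separatingCount_four,
      zero_mul, add_zero, zero_add] at h
    have h' := congrArg (Nat.cast : ℕ → ℤ) h
    push_cast [cast_descFactorial_succ, Nat.descFactorial_zero] at h'
    rw [h']
    simp (discharger := decide) only [symMon_self, symMon_self_right, symMon_self_left,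
      symMon_of_ne]
    ring
  · have h := factorial_mul_ncard r s n 5
    simp only [Finset.sum_range_succ, Finset.sum_range_zero] at h
    simp only [separatingCount_comm_left, separatingCount_comm_right] at h
    simp (discharger := decide) only [separatingCount_eq_zero, separatingCount_five,
      zero_mul, add_zero, zero_add] at h
    have h' := congrArg (Nat.cast : ℕ → ℤ) h
    push_cast [cast_descFactorial_succ, Nat.descFactorial_zero] at h'
    rw [h']
    simp (discharger := decide) only [symMon_self, symMon_self_right, symMon_self_left,
      symMon_of_ne]
    ring
  · have h := factorial_mul_ncard r s n 6
    simp only [Finset.sum_range_succ, Finset.sum_range_zero] at h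
    simp only [separatingCount_comm_left, separatingCount_comm_right] at h
    simp (discharger := decide) only [separatingCount_eq_zero, separatingCount_six,
      zero_mul, add_zero, zero_add] at h
    have h' := congrArg (Nat.cast : ℕ → ℤ) h
    push_cast [cast_descFactorial_succ, Nat.descFactorial_zero] at h'
    rw [h']
    simp (discharger := decide) only [symMon_self, symMon_self_right, symMon_self_left,
      symMon_of_ne]
    ring
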